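/- Let $X$ be an infinite countable set, $m:X\to(0,\infty)$, and $p\in(1,\infty)$. A \emph{connected graph} over $(X,m)$ is a symmetric function $b:X\times X\to[0,\infty)$ with zero diagonal and $\sum_{y}b(x,y)<\infty$ for all $x$, such that any two points are joined by a finite path $x_0\sim\dots\sim x_n$, where $x\sim y$ means $b(x,y)>0$. Write $a^{\langle r\rangle}=a|a|^{r-1}$ for $a\ne 0$, $0^{\langle r\rangle}=0$, $\nabla_{xy}f=f(x)-f(y)$, $f_+=f\vee 0$, and $$\mathcal F_b(X)=\Big\{f:X\to\mathbb R \ \Big|\ \sum_{y}b(x,y)|\nabla_{xy}f|^{p-1}<\infty\ \text{for all }x\Big\}.$$ For $V:X\to\mathbb R$, the quasilinear Schrödinger operator associated to $b$ and $V$ is $$\mathcal H[f](x)=\frac1{m(x)}\sum_{y}b(x,y)(\nabla_{xy}f)^{\langle p-1\rangle}+V(x)f(x)^{\langle p-1\rangle},\qquad f\in\mathcal F_b(X),$$ and its energy functional, on finitely supported $\varphi$, is $$\mathcal Q_V(\varphi)=\tfrac12\sum_{x,y}b(x,y)|\nabla_{xy}\varphi|^p+\sum_x m(x)V(x)|\varphi(x)|^p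 .$$ A function $f:X\to\mathbb R$ is \emph{positive} if $f\ge0$ and $f\ne0$, and strictly positive if $f(x)>0$ for all $x$. A function $f\in\mathcal F_b(X)$ is \emph{superharmonic} (\emph{harmonic}) for $\mathcal H$ if $\mathcal H[f]\ge 0$ ($\mathcal H[f]=0$) on $X$. The operator $\mathcal H$ is \emph{positive} if it admits a positive superharmonic function. It is \emph{critical} if $\mathcal Q_V\ge0$ on finitely supported functions and there is no positive $W:X\to\mathbb R$ with $\mathcal Q_{V-W}\ge0$ on finitely supported functions. An \emph{Agmon ground state} of $\mathcal H$ is a strictly positive harmonic function such that every positive superharmonic function of $\mathcal H$ is a positive constant multiple of it. \textbf{Theorem (Liouville comparison principle).} Let $\mathcal H$ and $\tilde{\mathcal H}$ be positive quasilinear Schrödinger operators (with the same $p$) associated to connected graphs $b,\tilde b$ over $(X,m)$ and potentials $V,\tilde V$. Let $u\in\mathcal F_b(X)$ and $v\in\mathcal F_{\tilde b}(X)$ be such that \begin{itemize} \item[(a)] $\tilde{\mathcal H}$ is critical and $v>0$ is its Agmon ground state; \item[(b)] $u_+\neq0$ and $\mathcal H[u_+]\le0$ on $X$; \item[(c)]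 for some $C>0$ and all $x,y\in X$ with $u(x)>0$ and $u(y)>0$, $$b(x,y)^{2/p}\,u_+(x)u_+(y)\le C\,\tilde b(x,y)^{2/p}\,v(x)v(y),$$ and, if moreover $b(x,y)>0$, $$b(x,y)^{1-2/p}|\nabla_{xy}u_+|^{p-2}\le C\,\tilde b(x,y)^{1-2/p}|\nabla_{xy}v|^{p-2},$$ where both sides of the second inequality are taken in $[0,\infty]$, with $0^{s}=\infty$ for $s<0$ and $0^0=1$. \end{itemize} Then $\mathcal H$ is critical, $u(x)>0$ for all $x\in X$, and $u$ is an Agmon ground state of $\mathcal H$. -/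

import Mathlib

open scoped ENNReal

noncomputable section

namespace GraphSchrodinger

variable {X : Type*}

/-- `b` is a connected weighted graph over the vertex set `X`: nonnegative symmetric edge weights
with zero diagonal, summable at every vertex, such that any two vertices are joined by a finite
path of edges of strictly positive weight. -/
structure IsConnectedGraph (b : X → X → ℝ) : Prop where
  nonneg : ∀ x y, 0 ≤ b x y
  symm : ∀ x y, b x y = b y x
  diag : ∀ x, b x x = 0
  summable : ∀ x, Summable (fun y => b x y)
  connected : ∀ x y, Relation.ReflTransGen (fun z w => 0 < b z w) x y

/-- The signed power `a^⟨r⟩ = a |a|^(r-1)`; it vanishes at `a = 0`. -/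
def signedPow (a r : ℝ) : ℝ := a * |a| ^ (r - 1)

/-- A positive function: pointwise nonnegative and not identically zero. -/
def IsPositive (f : X → ℝ) : Prop := (∀ x, 0 ≤ f x) ∧ f ≠ 0

/-- The positive part `f₊ = f ∨ 0`. -/
def positivePart (f : X → ℝ) : X → ℝ := fun x => max (f x) 0

/-- The domain `F_b(X)` of the `p`-Laplacian. -/
def formalDomain (p : ℝ) (b : X → X → ℝ) : Set (X → ℝ) :=
  {f | ∀ x, Summable (fun y => b x y * |f x - f y| ^ (p - 1))}

/-- The weighted `p`-Laplacian `Δ_p`, used on functions of the formal domain. -/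
def pLaplacian (p : ℝ) (b : X → X → ℝ) (m : X → ℝ) (f : X → ℝ) (x : X) : ℝ :=
  (1 / m x) * ∑' y, b x y * signedPow (f x - f y) (p - 1)

/-- The quasilinear Schrödinger operator `Δ_p + V`, used on functions of the formal domain. -/
def schrodinger (p : ℝ) (b : X → X → ℝ) (m V : X → ℝ) (f : X → ℝ) (x : X) : ℝ :=
  pLaplacian p b m f x + V x * signedPow (f x) (p - 1)

/-- The energy functional `Q_{p,b,m,V}`, used on finitely supported functions
(for which both sums converge absolutely). -/
def energy (p : ℝ) (b : X → X → ℝ) (m V : X → ℝ) (φ : X → ℝ) : ℝ :=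
  (1 / 2) * ∑' z : X × X, b z.1 z.2 * |φ z.1 - φ z.2| ^ p + ∑' x, m x * V x * |φ x| ^ p

/-- `Q_{p,b,m,V} ≥ 0` on `C_c(X)`. -/
def EnergyNonneg (p : ℝ) (b : X → X → ℝ) (m V : X → ℝ) : Prop :=
  ∀ φ : X → ℝ, (Function.support φ).Finite → 0 ≤ energy p b m V φ

/-- Superharmonic functions of `Δ_p + V`. -/
def IsSuperharmonic (p : ℝ) (b : X → X → ℝ) (m V : X → ℝ) (f : X → ℝ) : Prop :=
  f ∈ formalDomain p b ∧ ∀ x, 0 ≤ schrodinger p b m V f x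

/-- Subharmonic functions of `Δ_p + V`. -/
def IsSubharmonic (p : ℝ) (b : X → X → ℝ) (m V : X → ℝ) (f : X → ℝ) : Prop :=
  f ∈ formalDomain p b ∧ ∀ x, schrodinger p b m V f x ≤ 0

/-- Harmonic functions of `Δ_p + V`. -/
def IsHarmonic (p : ℝ) (b : X → X → ℝ) (m V : X → ℝ) (f : X → ℝ) : Prop :=
  IsSuperharmonic p b m V f ∧ IsSubharmonic p b m V f

/-- `Δ_p + V ≥ 0`: the operator admits a positive superharmonic function. -/
def IsPositiveOperator (p : ℝ) (b : X → X → ℝ) (m V : X → ℝ) : Prop :=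
  ∃ f : X → ℝ, IsPositive f ∧ IsSuperharmonic p b m V f

/-- The (nonnegative) energy functional is subcritical: it admits a positive Hardy weight `W`. -/
def IsSubcritical (p : ℝ) (b : X → X → ℝ) (m V : X → ℝ) : Prop :=
  EnergyNonneg p b m V ∧
    ∃ W : X → ℝ, IsPositive W ∧ EnergyNonneg p b m (fun x => V x - W x)

/-- `Δ_p + V` is critical: its energy functional is nonnegative and not subcritical. -/
def IsCritical (p : ℝ) (b : X → X → ℝ) (m V : X → ℝ) : Prop :=
  EnergyNonneg p b m V ∧ ¬ IsSubcritical p b m V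

/-- `f` is an Agmon ground state of `Δ_p + V`: a strictly positive harmonic function which is,
up to positive multiples, the only positive superharmonic function. -/
structure IsAgmonGroundState (p : ℝ) (b : X → X → ℝ) (m V : X → ℝ) (f : X → ℝ) : Prop where
  pos : ∀ x, 0 < f x
  harmonic : IsHarmonic p b m V f
  unique : ∀ g : X → ℝ, IsPositive g → IsSuperharmonic p b m V g →
    ∃ c : ℝ, 0 < c ∧ ∀ x, g x = c * f x

/-- The quantity `b^(1-2/p) |∇f|^(p-2)` at the pair `(x, y)`, with values in `[0, ∞]`, so that
`0` to a negative power is `∞` (and `0` to the power `0` is `1`). -/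
def gradWeight (p : ℝ) (b : X → X → ℝ) (f : X → ℝ) (x y : X) : ℝ≥0∞ :=
  ENNReal.ofReal (b x y) ^ (1 - 2 / p) * ENNReal.ofReal |f x - f y| ^ (p - 2)

end GraphSchrodinger

end

/-! For `f ≥ 0` and finitely supported `ψ ≥ 0`, the energy of `f ψ` equals `∑ m H[f] f ψ^p` plus
half the `b`-weighted sum of Picone remainders over ordered pairs (`hasSum_piconeRemainder`). The
remainders are nonnegative for `f > 0`, so the energy dominates them if `f` is superharmonic, and is
at most half their sum if `f` is subharmonic.

Each remainder is comparable to an explicit expression, the simplified energy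
(`piconeRemainder_bounds`), and (c) bounds that of `u₊` over `b` by that of `v` over `b'`
(`exists_piconeRemainder_comparison`). Criticality of the second operator gives a null sequence `φ
n` with `φ n o = 1`. Put `ψ n = φ n / v`. The remainders of `v` tend to zero, which forces `ψ n → 1
/ v o` (`tendsto_of_edges`), and by comparison the energies of `u₊ ψ n` are bounded by a null
sequence.

If `g` is any positive superharmonic function of the first operator, the same argument makes `u₊ ψ n
/ g` converge to a constant, so `u₊` is a positive multiple of `g`. Positivity of `u`, harmonicity
and uniqueness follow; the nonzero limit of the null sequence excludes a Hardy weight. -/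

namespace GraphSchrodinger

/-! ### Elementary estimates for powers and signed powers. -/

theorem rpow_le_of_comparable {k a n : ℝ} (e : ℝ) (ha : 0 < a) (hn : 0 < n)
    (h₁ : a ≤ k * n) (h₂ : n ≤ k * a) : n ^ e ≤ k ^ |e| * a ^ e := by
  have hk : 0 < k := by
    by_contra hk
    nlinarith [mul_nonneg (neg_nonneg.2 (not_lt.1 hk)) ha.le]
  rcases le_total 0 e with he | he
  · rw [abs_of_nonneg he, ← Real.mul_rpow hk.le ha.le]
    exact Real.rpow_le_rpow hn.le h₂ he
  · rw [abs_of_nonpos he, Real.rpow_neg hk.le, ← Real.inv_rpow hk.le,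
      ← Real.mul_rpow (inv_nonneg.2 hk.le) ha.le]
    apply Real.rpow_le_rpow_of_nonpos (by positivity) _ he
    rw [inv_mul_le_iff₀ hk]
    exact h₁

/-- Scaling by `a` reduces this to comparing `1 - q ^ r` with `1 - q` on `[0, 1]`: one side is
Bernoulli's inequality, the other monotonicity in the exponent. -/
theorem rpow_sub_rpow_bounds {r a c : ℝ} (hr : 0 < r) (hc : 0 ≤ c) (hca : c ≤ a) (ha : 0 < a) :
    min 1 r * ((a - c) * a ^ (r - 1)) ≤ a ^ r - c ^ r ∧
      a ^ r - c ^ r ≤ max 1 r * ((a - c) * a ^ (r - 1)) := by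
  obtain ⟨q, rfl⟩ : ∃ q, c = a * q := ⟨c / a, by field_simp⟩
  have hq : 0 ≤ q := nonneg_of_mul_nonneg_right hc ha
  have hq1 : q ≤ 1 := by
    by_contra h
    nlinarith
  have hE : (a - a * q) * a ^ (r - 1) = (1 - q) * a ^ r := by
    rw [Real.rpow_sub_one ha.ne']
    field_simp
  rw [hE, Real.mul_rpow ha.le hq]
  have har : 0 < a ^ r := Real.rpow_pos_of_pos ha r
  suffices h : min 1 r * (1 - q) ≤ 1 - q ^ r ∧ 1 - q ^ r ≤ max 1 r * (1 - q) by
    constructor <;> nlinarith [h.1, h.2]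
  rcases le_total 1 r with h | h
  · rw [min_eq_left h, max_eq_right h]
    have h1 := one_add_mul_self_le_rpow_one_add (s := q - 1) (by linarith) h
    have h2 : q ^ r ≤ q ^ (1 : ℝ) := Real.rpow_le_rpow_of_exponent_ge' hq hq1 zero_le_one h
    rw [Real.rpow_one] at h2
    rw [show 1 + (q - 1) = q by ring] at h1
    constructor <;> linarith
  · rw [min_eq_right h, max_eq_left h]
    have h1 := rpow_one_add_le_one_add_mul_self (s := q - 1) (by linarith) hr.le h
    have h2 : q ^ (1 : ℝ) ≤ q ^ r := Real.rpow_le_rpow_of_exponent_ge' hq hq1 hr.le h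
    rw [Real.rpow_one] at h2
    rw [show 1 + (q - 1) = q by ring] at h1
    constructor <;> linarith

theorem signedPow_neg (a r : ℝ) : signedPow (-a) r = -signedPow a r := by
  simp [signedPow]

theorem signedPow_zero (r : ℝ) : signedPow 0 r = 0 := by
  simp [signedPow]

theorem signedPow_of_nonneg {a r : ℝ} (hr : 0 < r) (ha : 0 ≤ a) : signedPow a r = a ^ r := by
  rcases ha.eq_or_lt with rfl | ha
  · simp [signedPow, Real.zero_rpow hr.ne']
  · rw [signedPow, abs_of_pos ha, Real.rpow_sub_one ha.ne']
    field_simp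

theorem abs_signedPow {r : ℝ} (hr : 0 < r) (a : ℝ) : |signedPow a r| = |a| ^ r := by
  have h := signedPow_of_nonneg hr (abs_nonneg a)
  rw [signedPow, abs_abs] at h
  rw [signedPow, abs_mul, abs_of_nonneg (Real.rpow_nonneg (abs_nonneg a) _), h]

theorem signedPow_mul_of_nonneg {a r : ℝ} (hr : 0 < r) (ha : 0 ≤ a) (c : ℝ) :
    signedPow (c * a) r = signedPow c r * a ^ r := by
  rw [← signedPow_of_nonneg hr ha, signedPow, signedPow, signedPow, abs_mul,
    Real.mul_rpow (abs_nonneg _) (abs_nonneg _)]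
  ring

/-- A two-sided mean value estimate: `|y| + (x - y)` is comparable to the larger of `|x|` and `|y|`.
-/
theorem signedPow_sub_bounds {r : ℝ} (hr : 0 < r) :
    ∃ c C : ℝ, 0 < c ∧ 0 < C ∧ ∀ x y : ℝ, y < x →
      c * ((x - y) * (|y| + (x - y)) ^ (r - 1)) ≤ signedPow x r - signedPow y r ∧
      signedPow x r - signedPow y r ≤ C * ((x - y) * (|y| + (x - y)) ^ (r - 1)) := by
  set k : ℝ := 2 ^ |r - 1| with hk
  have hk1 : 1 ≤ k := Real.one_le_rpow one_le_two (abs_nonneg _)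
  have hk0 : 0 < k := by positivity
  set l : ℝ := min (min 1 r) (2⁻¹ ^ r) with hl
  have hl0 : 0 < l := by positivity
  set L : ℝ := max 1 r + 2 with hL
  have hL0 : 0 < L := by positivity
  refine ⟨l / k, L * k, by positivity, by positivity, fun x y hxy => ?_⟩
  have hd : 0 < x - y := sub_pos.2 hxy
  have hN : 0 < |y| + (x - y) := by positivity
  -- The size may be replaced by a comparable one adapted to the signs: `x`, `-y`, or `x - y` when
  -- `y < 0 < x`.
  suffices h : ∃ a, 0 < a ∧ a ≤ 2 * (|y| + (x - y)) ∧ |y| + (x - y) ≤ 2 * a ∧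
      l * ((x - y) * a ^ (r - 1)) ≤ signedPow x r - signedPow y r ∧
      signedPow x r - signedPow y r ≤ L * ((x - y) * a ^ (r - 1)) by
    obtain ⟨a, ha, h1, h2, h3, h4⟩ := h
    have e1 := rpow_le_of_comparable (r - 1) ha hN h1 h2
    have e2 := rpow_le_of_comparable (r - 1) hN ha h2 h1
    constructor
    · refine le_trans ?_ h3
      rw [div_mul_eq_mul_div, div_le_iff₀ hk0]
      calc l * ((x - y) * (|y| + (x - y)) ^ (r - 1))
          ≤ l * ((x - y) * (k * a ^ (r - 1))) := by gcongr
        _ = _ := by ring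
    · refine h4.trans ?_
      calc L * ((x - y) * a ^ (r - 1))
          ≤ L * ((x - y) * (k * (|y| + (x - y)) ^ (r - 1))) := by gcongr
        _ = _ := by ring
  have key : ∀ a c : ℝ, 0 ≤ c → c < a →
      l * ((a - c) * a ^ (r - 1)) ≤ a ^ r - c ^ r ∧
      a ^ r - c ^ r ≤ L * ((a - c) * a ^ (r - 1)) := by
    intro a c hc hca
    have ha := hc.trans_lt hca
    obtain ⟨h1, h2⟩ := rpow_sub_rpow_bounds hr hc hca.le ha
    have hp : 0 ≤ (a - c) * a ^ (r - 1) :=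
      mul_nonneg (sub_nonneg.2 hca.le) (Real.rpow_nonneg ha.le _)
    exact ⟨(mul_le_mul_of_nonneg_right (min_le_left _ _) hp).trans h1,
      h2.trans (mul_le_mul_of_nonneg_right (by linarith) hp)⟩
  rcases le_or_gt 0 y with hy | hy
  · have hx : 0 < x := hy.trans_lt hxy
    refine ⟨x, hx, ?_, ?_, ?_⟩
    · rw [abs_of_nonneg hy]; linarith
    · rw [abs_of_nonneg hy]; linarith
    · rw [signedPow_of_nonneg hr hx.le, signedPow_of_nonneg hr hy]
      exact key x y hy hxy
  · rcases le_or_gt x 0 with hx | hx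
    · refine ⟨-y, by linarith, ?_, ?_, ?_⟩
      · rw [abs_of_neg hy]; linarith
      · rw [abs_of_neg hy]; linarith
      · have h := key (-y) (-x) (by linarith) (by linarith)
        have e1 : signedPow x r = -(-x) ^ r := by
          rw [← signedPow_of_nonneg hr (by linarith : 0 ≤ -x), signedPow_neg, neg_neg]
        have e2 : signedPow y r = -(-y) ^ r := by
          rw [← signedPow_of_nonneg hr (by linarith : 0 ≤ -y), signedPow_neg, neg_neg]
        rw [e1, e2]
        rw [show -y - -x = x - y by ring, show (-y) ^ r - (-x) ^ r = -(-x) ^ r - -(-y) ^ r by ring]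
          at h
        exact h
    · refine ⟨x - y, hd, ?_, ?_, ?_⟩
      · rw [abs_of_neg hy]; linarith
      · rw [abs_of_neg hy]; linarith
      · have e2 : signedPow y r = -(-y) ^ r := by
          rw [← signedPow_of_nonneg hr (by linarith : 0 ≤ -y), signedPow_neg, neg_neg]
        have e3 : (x - y) * (x - y) ^ (r - 1) = (x - y) ^ r := by
          rw [Real.rpow_sub_one hd.ne']; field_simp
        rw [signedPow_of_nonneg hr hx.le, e2, e3, sub_neg_eq_add]
        have hx0 : 0 ≤ x ^ r := Real.rpow_nonneg hx.le r
        have hy0 : 0 ≤ (-y) ^ r := Real.rpow_nonneg (by linarith) r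
        have hd0 : 0 ≤ (x - y) ^ r := Real.rpow_nonneg hd.le r
        constructor
        · have h1 : l * (x - y) ^ r ≤ (2⁻¹ * (x - y)) ^ r := by
            rw [Real.mul_rpow (by norm_num) hd.le]
            exact mul_le_mul_of_nonneg_right (min_le_right _ _) hd0
          rcases le_total x (-y) with h | h
          · have := Real.rpow_le_rpow (by positivity) (by linarith : 2⁻¹ * (x - y) ≤ -y) hr.le
            linarith
          · have := Real.rpow_le_rpow (by positivity) (by linarith : 2⁻¹ * (x - y) ≤ x) hr.le
            linarith
        · have h1 := Real.rpow_le_rpow hx.le (by linarith : x ≤ x - y) hr.le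
          have h2 := Real.rpow_le_rpow (by linarith) (by linarith : -y ≤ x - y) hr.le
          have h3 : 2 * (x - y) ^ r ≤ L * (x - y) ^ r :=
            mul_le_mul_of_nonneg_right
              (by rw [hL]; linarith [le_max_left 1 r]) hd0
          linarith

/-! ### Picone remainders and their two-sided bounds. -/

/-- The remainder in Picone's inequality on an edge, for a function with values `s`, `t` at the
end points, multiplied by a function with values `a`, `c`. -/
noncomputable def piconeRemainder (p s t a c : ℝ) : ℝ :=
  |s * a - t * c| ^ p - signedPow (s - t) (p - 1) * (s * a ^ p - t * c ^ p)

theorem piconeRemainder_swap (p s t a c : ℝ) :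
    piconeRemainder p s t a c = piconeRemainder p t s c a := by
  rw [piconeRemainder, piconeRemainder, abs_sub_comm, ← neg_sub t s, signedPow_neg]
  ring

theorem piconeRemainder_self {p : ℝ} (hp : 1 < p) (s t : ℝ) {a : ℝ} (ha : 0 ≤ a) :
    piconeRemainder p s t a a = 0 := by
  have h : signedPow (s - t) (p - 1) * (s - t) = |s - t| ^ p := by
    rcases eq_or_ne (s - t) 0 with h | h
    · simp [h, Real.zero_rpow (by linarith : p ≠ 0)]
    · rw [signedPow, show p - 1 - 1 = p - 2 by ring, Real.rpow_sub (abs_pos.2 h), Real.rpow_two,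
        sq_abs]
      field_simp
  rw [piconeRemainder, ← sub_mul, abs_mul, abs_of_nonneg ha, Real.mul_rpow (abs_nonneg _) ha,
    ← sub_mul, ← mul_assoc, h, sub_self]

/-- The arguments of the two signed powers differ by `t * (a - c)`, so `signedPow_sub_bounds`
controls this derivative. -/
theorem hasDerivAt_piconeRemainder {p : ℝ} (hp : 1 < p) (s t c : ℝ) {a : ℝ} (ha : 0 < a) :
    HasDerivAt (fun a => piconeRemainder p s t a c)
      (p * s * (signedPow (s * a - t * c) (p - 1) - signedPow ((s - t) * a) (p - 1))) a := by
  have h1 : HasDerivAt (fun a => s * a - t * c) s a := by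
    simpa using ((hasDerivAt_id a).const_mul s).sub_const (t * c)
  have h2 := (hasDerivAt_abs_rpow (s * a - t * c) hp).comp a h1
  have h3 := (((Real.hasDerivAt_rpow_const (p := p) (Or.inl ha.ne')).const_mul s).sub_const
    (t * c ^ p)).const_mul (signedPow (s - t) (p - 1))
  refine (h2.sub h3).congr_deriv ?_
  rw [signedPow_mul_of_nonneg (by linarith) ha.le, signedPow.eq_1 (s * a - t * c), show p - 1 - 1 = p - 2 by ring]
  ring

theorem continuousOn_sq_mul_rpow {p A K : ℝ} (hp : 1 < p) (hA : 0 ≤ A) (hK : 0 < K) :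
    ContinuousOn (fun h : ℝ => h ^ 2 * (A + K * h) ^ (p - 2)) (Set.Ici 0) := by
  rcases hA.eq_or_lt with rfl | hA
  · have h : ContinuousOn (fun h : ℝ => K ^ (p - 2) * h ^ p) (Set.Ici 0) :=
      continuousOn_const.mul (continuousOn_id.rpow_const fun _ _ => Or.inr (by linarith))
    refine h.congr fun x hx => ?_
    rcases (Set.mem_Ici.1 hx).eq_or_lt with rfl | hx
    · simp [Real.zero_rpow (by linarith : p ≠ 0)]
    · simp only [zero_add]
      rw [Real.mul_rpow hK.le hx.le, Real.rpow_sub hx, Real.rpow_two]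
      field_simp
  · refine (continuousOn_pow 2).mul (ContinuousOn.rpow_const (by fun_prop) fun x hx => Or.inl ?_)
    have := mul_nonneg hK.le (Set.mem_Ici.1 hx)
    positivity

/-- As functions of `h`, both sides vanish at `0` and have comparable derivatives on `(0, ∞)`. -/
theorem piconeRemainder_bounds_of_lt {p : ℝ} (hp : 1 < p) :
    ∃ c C : ℝ, 0 < c ∧ 0 < C ∧ ∀ s t a h : ℝ, 0 < s → 0 < t → 0 ≤ a → 0 < h →
      c * (s * t * (h ^ 2 * (|s - t| * a + (|s - t| + t) * h) ^ (p - 2)))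
        ≤ piconeRemainder p s t (a + h) a ∧
      piconeRemainder p s t (a + h) a
        ≤ C * (s * t * (h ^ 2 * (|s - t| * a + (|s - t| + t) * h) ^ (p - 2))) := by
  obtain ⟨c, C, hc, hC, hcC⟩ := signedPow_sub_bounds (sub_pos.2 hp)
  have hp0 : 0 < p := by linarith
  have hM : 0 < max 2 p := by positivity
  have hm : 0 < min 2 p := by positivity
  refine ⟨p * c / max 2 p, p * C / min 2 p, by positivity, by positivity,
    fun s t a h hs ht ha hh => ?_⟩
  set A := |s - t| * a with hA
  set K := |s - t| + t with hK
  have hA0 : 0 ≤ A := by positivity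
  have hK0 : 0 < K := by positivity
  set F : ℝ → ℝ := fun h => h ^ 2 * (A + K * h) ^ (p - 2) with hF
  -- The fraction lies in `[0, 1]`, so the last factor lies between `min 2 p` and `max 2 p`.
  set F' : ℝ → ℝ := fun h => h * (A + K * h) ^ (p - 2) * (2 + (p - 2) * (K * h / (A + K * h)))
    with hF'
  set G : ℝ → ℝ := fun h => piconeRemainder p s t (a + h) a with hG
  set G' : ℝ → ℝ := fun h => p * s *
    (signedPow (s * (a + h) - t * a) (p - 1) - signedPow ((s - t) * (a + h)) (p - 1)) with hG'
  have hFd : ∀ x, 0 < x → HasDerivAt F (F' x) x := by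
    intro x hx
    have hN : 0 < A + K * x := by positivity
    have h1 : HasDerivAt (fun x => A + K * x) K x := by
      simpa using ((hasDerivAt_id x).const_mul K).const_add A
    have h2 := (hasDerivAt_pow 2 x).mul (h1.rpow_const (p := p - 2) (Or.inl hN.ne'))
    refine h2.congr_deriv ?_
    rw [Real.rpow_sub_one hN.ne' (p - 2), hF']
    simp only [Nat.cast_ofNat, Nat.add_one_sub_one, pow_one]
    field_simp
  have hGd : ∀ x, 0 < x → HasDerivAt G (G' x) x := by
    intro x hx
    have h1 : HasDerivAt (fun x => a + x) 1 x := (hasDerivAt_id x).const_add a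
    simpa [Function.comp_def] using
      (hasDerivAt_piconeRemainder hp s t a (by positivity : 0 < a + x)).comp x h1
  have hF0 : F 0 = 0 := by simp [hF]
  have hG0 : G 0 = 0 := by simp [hG, piconeRemainder_self hp s t ha]
  have hFc : ContinuousOn F (Set.Ici 0) := continuousOn_sq_mul_rpow hp hA0 hK0
  have hGc : ContinuousOn G (Set.Ici 0) := by
    have : Continuous G := by
      simp only [hG, piconeRemainder]
      refine Continuous.sub ?_ ?_
      · exact Continuous.rpow_const (by fun_prop) fun _ => Or.inr hp0.le
      · exact continuous_const.mul ((continuous_const.mul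
          (Continuous.rpow_const (by fun_prop) fun _ => Or.inr hp0.le)).sub continuous_const)
    exact this.continuousOn
  have hF'b : ∀ x, 0 < x → min 2 p * (x * (A + K * x) ^ (p - 2)) ≤ F' x ∧
      F' x ≤ max 2 p * (x * (A + K * x) ^ (p - 2)) := by
    intro x hx
    have hN : 0 < A + K * x := by positivity
    have hP : 0 ≤ x * (A + K * x) ^ (p - 2) := by positivity
    have ht0 : 0 ≤ K * x / (A + K * x) := by positivity
    have ht1 : K * x / (A + K * x) ≤ 1 := by
      rw [div_le_one hN]; linarith
    simp only [hF']
    rw [mul_comm (x * _)]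
    constructor
    · refine mul_le_mul_of_nonneg_right ?_ hP
      rcases le_total 2 p with h | h
      · rw [min_eq_left h]; nlinarith
      · rw [min_eq_right h]; nlinarith
    · refine mul_le_mul_of_nonneg_right ?_ hP
      rcases le_total 2 p with h | h
      · rw [max_eq_right h]; nlinarith
      · rw [max_eq_left h]; nlinarith
  have hG'b : ∀ x, 0 < x → p * c * (s * t * (x * (A + K * x) ^ (p - 2))) ≤ G' x ∧
      G' x ≤ p * C * (s * t * (x * (A + K * x) ^ (p - 2))) := by
    intro x hx
    have h1 := hcC (s * (a + x) - t * a) ((s - t) * (a + x)) (by nlinarith [mul_pos ht hx])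
    have e1 : s * (a + x) - t * a - (s - t) * (a + x) = t * x := by ring
    have e2 : |(s - t) * (a + x)| + t * x = A + K * x := by
      rw [abs_mul, abs_of_pos (by positivity : 0 < a + x), hA, hK]; ring
    rw [e1, e2, show p - 1 - 1 = p - 2 by ring] at h1
    have hps : 0 ≤ p * s := by positivity
    constructor
    · refine le_trans (le_of_eq ?_) (mul_le_mul_of_nonneg_left h1.1 hps); ring
    · refine (mul_le_mul_of_nonneg_left h1.2 hps).trans (le_of_eq ?_); ring
  have mono : ∀ k l : ℝ, (∀ x, 0 < x → 0 ≤ k * G' x + l * F' x) → 0 ≤ k * G h + l * F h := by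
    intro k l hkl
    have hd : ∀ x, 0 < x → HasDerivAt (fun x => k * G x + l * F x) (k * G' x + l * F' x) x :=
      fun x hx => ((hGd x hx).const_mul k).add ((hFd x hx).const_mul l)
    have := monotoneOn_of_deriv_nonneg (f := fun x => k * G x + l * F x) (convex_Ici (0 : ℝ))
      ((continuousOn_const.mul hGc).add (continuousOn_const.mul hFc))
      (fun x hx => by
        rw [interior_Ici] at hx
        exact (hd x hx).differentiableAt.differentiableWithinAt)
      (fun x hx => by
        rw [interior_Ici] at hx
        rw [(hd x hx).deriv]
        exact hkl x hx)
    have h0 := this (Set.mem_Ici.2 le_rfl) (Set.mem_Ici.2 hh.le) hh.le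
    simpa [hF0, hG0] using h0
  constructor
  · have := mono (max 2 p) (-(p * c * (s * t))) fun x hx => by
      have h1 := mul_le_mul_of_nonneg_left (hG'b x hx).1 hM.le
      have h2 := mul_le_mul_of_nonneg_left (hF'b x hx).2 (by positivity : 0 ≤ p * c * (s * t))
      nlinarith [h1, h2]
    rw [div_mul_eq_mul_div, div_le_iff₀ hM]
    change _ ≤ G h * _
    change p * c * (s * t * F h) ≤ _
    linarith
  · have := mono (-(min 2 p)) (p * C * (s * t)) fun x hx => by
      have h1 := mul_le_mul_of_nonneg_left (hG'b x hx).2 hm.le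
      have h2 := mul_le_mul_of_nonneg_left (hF'b x hx).1 (by positivity : 0 ≤ p * C * (s * t))
      nlinarith [h1, h2]
    rw [div_mul_eq_mul_div, le_div_iff₀ hm]
    change G h * _ ≤ _
    change _ ≤ p * C * (s * t * F h)
    linarith

/-- The simplified energy of an edge. -/
noncomputable def simplifiedEnergy (p s t a c : ℝ) : ℝ :=
  s * t * (|a - c| ^ 2 * (√(s * t) * |a - c| + |s - t| * max a c) ^ (p - 2))

theorem simplifiedEnergy_swap (p s t a c : ℝ) :
    simplifiedEnergy p s t a c = simplifiedEnergy p t s c a := by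
  rw [simplifiedEnergy, simplifiedEnergy, abs_sub_comm a c, abs_sub_comm s t, max_comm, mul_comm s]

/-- By symmetry the larger value may be taken first; then the bases of the power `p - 2` here and in
`piconeRemainder_bounds_of_lt` agree up to a factor 4. -/
theorem piconeRemainder_bounds {p : ℝ} (hp : 1 < p) :
    ∃ c C : ℝ, 0 < c ∧ 0 < C ∧ ∀ s t x y : ℝ, 0 < s → 0 < t → 0 ≤ x → 0 ≤ y →
      c * simplifiedEnergy p s t x y ≤ piconeRemainder p s t x y ∧
      piconeRemainder p s t x y ≤ C * simplifiedEnergy p s t x y := by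
  obtain ⟨c, C, hc, hC, hcC⟩ := piconeRemainder_bounds_of_lt hp
  set k : ℝ := 4 ^ |p - 2| with hk
  have hk0 : 0 < k := by positivity
  refine ⟨c / k, C * k, by positivity, by positivity, ?_⟩
  suffices H : ∀ s t x y : ℝ, 0 < s → 0 < t → 0 ≤ x → 0 ≤ y → y ≤ x →
      c / k * simplifiedEnergy p s t x y ≤ piconeRemainder p s t x y ∧
      piconeRemainder p s t x y ≤ C * k * simplifiedEnergy p s t x y by
    intro s t x y hs ht hx hy
    rcases le_total y x with h | h
    · exact H s t x y hs ht hx hy h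
    · rw [piconeRemainder_swap, simplifiedEnergy_swap]
      exact H t s y x ht hs hy hx h
  intro s t x y hs ht hx hy hyx
  rcases hyx.eq_or_lt with rfl | hlt
  · rw [piconeRemainder_self hp s t hx]
    simp [simplifiedEnergy]
  obtain ⟨h, rfl⟩ : ∃ h, x = y + h := ⟨x - y, by ring⟩
  have hh : 0 < h := by linarith
  obtain ⟨h1, h2⟩ := hcC s t y h hs ht hy hh
  rw [simplifiedEnergy, add_sub_cancel_left, abs_of_pos hh, max_eq_left hyx]
  set N := |s - t| * y + (|s - t| + t) * h with hN
  set M := √(s * t) * h + |s - t| * (y + h) with hM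
  have hr : 0 < √(s * t) := Real.sqrt_pos.2 (by positivity)
  have hr2 : √(s * t) ^ 2 = s * t := Real.sq_sqrt (by positivity)
  have hd := abs_nonneg (s - t)
  have hN0 : 0 < N := by positivity
  have hM0 : 0 < M := by positivity
  have hdy : 0 ≤ |s - t| * y := by positivity
  have hdh : 0 ≤ |s - t| * h := by positivity
  have i1 : √(s * t) ≤ |s - t| + t := by
    rw [Real.sqrt_le_left (by positivity)]
    have := le_abs_self (s - t)
    nlinarith
  -- Otherwise `|s - t| ≤ t / 2`, so `s ≥ t / 2` and `√(s * t) > t / 2`, a contradiction.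
  have i2 : t ≤ 2 * √(s * t) + 2 * |s - t| := by
    have := neg_abs_le (s - t)
    by_contra hcon
    push Not at hcon
    have h4 : 2 * √(s * t) ≤ t := by linarith
    have h5 : 2 * s ≥ t := by linarith
    nlinarith
  have c1 : N ≤ 4 * M := by
    have := mul_le_mul_of_nonneg_right i2 hh.le
    have := mul_pos hr hh
    rw [hN, hM]; nlinarith
  have c2 : M ≤ 4 * N := by
    have := mul_le_mul_of_nonneg_right i1 hh.le
    have := mul_pos ht hh
    rw [hN, hM]; nlinarith
  have e1 := rpow_le_of_comparable (p - 2) hN0 hM0 c1 c2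
  have e2 := rpow_le_of_comparable (p - 2) hM0 hN0 c2 c1
  constructor
  · refine le_trans ?_ h1
    rw [div_mul_eq_mul_div, div_le_iff₀ hk0]
    calc c * (s * t * (h ^ 2 * M ^ (p - 2)))
        ≤ c * (s * t * (h ^ 2 * (k * N ^ (p - 2)))) := by gcongr
      _ = _ := by ring
  · refine h2.trans ?_
    calc C * (s * t * (h ^ 2 * N ^ (p - 2)))
        ≤ C * (s * t * (h ^ 2 * (k * M ^ (p - 2)))) := by gcongr
      _ = _ := by ring

theorem piconeRemainder_nonneg {p : ℝ} (hp : 1 < p) {s t x y : ℝ} (hs : 0 < s) (ht : 0 < t)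
    (hx : 0 ≤ x) (hy : 0 ≤ y) : 0 ≤ piconeRemainder p s t x y := by
  obtain ⟨c, C, hc, -, h⟩ := piconeRemainder_bounds hp
  refine le_trans ?_ (h s t x y hs ht hx hy).1
  have : 0 ≤ max x y := hx.trans (le_max_left _ _)
  unfold simplifiedEnergy
  positivity

/-- This is why (c) is needed only where `u > 0`: edges meeting the zero set of `u₊` do not
contribute. -/
theorem piconeRemainder_zero_left {p : ℝ} (hp : 1 < p) {t x y : ℝ} (ht : 0 ≤ t) (hy : 0 ≤ y) :
    piconeRemainder p 0 t x y = 0 := by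
  have h : t ^ p = t ^ (p - 1) * t := by
    rcases ht.eq_or_lt with rfl | ht
    · simp [Real.zero_rpow (by linarith : p ≠ 0)]
    · rw [Real.rpow_sub_one ht.ne']; field_simp
  rw [piconeRemainder, zero_sub, signedPow_neg, signedPow_of_nonneg (by linarith) ht, zero_mul,
    zero_mul, zero_sub, zero_sub, abs_neg, abs_of_nonneg (mul_nonneg ht hy), Real.mul_rpow ht hy, h]
  ring

theorem piconeRemainder_mul {p k : ℝ} (hp : 1 < p) (hk : 0 < k) (s t x y : ℝ) :
    piconeRemainder p (k * s) (k * t) x y = k ^ p * piconeRemainder p s t x y := by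
  rw [piconeRemainder, piconeRemainder, ← mul_sub, mul_comm k (s - t),
    signedPow_mul_of_nonneg (by linarith) hk.le, mul_assoc, mul_assoc, ← mul_sub, abs_mul,
    abs_of_pos hk, Real.mul_rpow hk.le (abs_nonneg _), Real.rpow_sub_one hk.ne']
  field_simp

/-! ### Edgewise comparison of remainders under condition (c). -/

theorem exists_le_mul_of_rpow_le {p C : ℝ} (hC : 0 < C) :
    ∃ K : ℝ, 1 ≤ K ∧ √C ≤ K ∧ ∀ a a' : ℝ, 0 ≤ a → 0 ≤ a' →
      ENNReal.ofReal a ^ (p - 2) ≤ ENNReal.ofReal C * ENNReal.ofReal a' ^ (p - 2) →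
      (2 < p → a ≤ K * a') ∧ (p < 2 → a' ≤ K * a) := by
  set k : ℝ := C ^ |p - 2|⁻¹ with hk
  refine ⟨max (max 1 √C) k, (le_max_left _ _).trans (le_max_left _ _),
    (le_max_right _ _).trans (le_max_left _ _), fun a a' ha ha' h => ⟨fun hp => ?_, fun hp => ?_⟩⟩
  · have hq : 0 < p - 2 := by linarith
    rw [ENNReal.ofReal_rpow_of_nonneg ha hq.le, ENNReal.ofReal_rpow_of_nonneg ha' hq.le,
      ← ENNReal.ofReal_mul hC.le, ENNReal.ofReal_le_ofReal_iff (by positivity)] at h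
    have h1 : C = k ^ (p - 2) := by
      rw [hk, abs_of_pos hq, Real.rpow_inv_rpow hC.le hq.ne']
    rw [h1, ← Real.mul_rpow (by positivity) ha', Real.rpow_le_rpow_iff ha (by positivity) hq] at h
    exact h.trans (mul_le_mul_of_nonneg_right (le_max_right _ _) ha')
  · have hq : 0 < 2 - p := by linarith
    rcases ha'.eq_or_lt with rfl | ha'
    · have : 0 ≤ max (max 1 √C) k := by positivity
      positivity
    -- For `p < 2`, `a = 0` would make the left side of `h` infinite while the right side is finite.
    have ha0 : 0 < a := by
      refine ha.lt_of_ne fun h0 => ?_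
      subst h0
      rw [ENNReal.ofReal_zero, ENNReal.zero_rpow_of_neg (by linarith),
        ENNReal.ofReal_rpow_of_pos ha'] at h
      exact absurd h (not_le.2 (ENNReal.mul_lt_top ENNReal.ofReal_lt_top ENNReal.ofReal_lt_top))
    rw [ENNReal.ofReal_rpow_of_pos ha0, ENNReal.ofReal_rpow_of_pos ha',
      ← ENNReal.ofReal_mul hC.le, ENNReal.ofReal_le_ofReal_iff (by positivity),
      ← neg_sub 2 p, Real.rpow_neg ha0.le, Real.rpow_neg ha'.le, ← div_eq_mul_inv,
      inv_le_iff_one_le_mul₀ (by positivity), div_mul_eq_mul_div, one_le_div (by positivity)] at h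
    have h1 : C = k ^ (2 - p) := by
      rw [hk, abs_of_neg (by linarith), neg_sub, Real.rpow_inv_rpow hC.le hq.ne']
    rw [h1, ← Real.mul_rpow (by positivity) ha0.le,
      Real.rpow_le_rpow_iff ha'.le (by positivity) hq] at h
    exact h.trans (mul_le_mul_of_nonneg_right (le_max_right _ _) ha0.le)

/-- The simplified energy increases with `s * t`; it increases with `|s - t|` for `p > 2` and
decreases for `p < 2`, which matches the direction of the gradient condition. -/
theorem exists_simplifiedEnergy_le {p C : ℝ} (hp : 1 < p) (hC : 0 < C) :
    ∃ D : ℝ, 0 < D ∧ ∀ s t s' t' x y : ℝ, 0 < s → 0 < t → 0 < s' → 0 < t' → 0 ≤ x → 0 ≤ y →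
      s * t ≤ C * (s' * t') →
      ENNReal.ofReal |s - t| ^ (p - 2) ≤ ENNReal.ofReal C * ENNReal.ofReal |s' - t'| ^ (p - 2) →
      simplifiedEnergy p s t x y ≤ D * simplifiedEnergy p s' t' x y := by
  obtain ⟨K, hK1, hCK, hK⟩ := exists_le_mul_of_rpow_le (p := p) hC
  have hK0 : 0 < K := by linarith
  refine ⟨K ^ (p + 2 * |p - 2|) , by positivity,
    fun s t s' t' x y hs ht hs' ht' hx hy h1 h2 => ?_⟩
  rcases eq_or_ne x y with rfl | hxy
  · simp [simplifiedEnergy]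
  obtain ⟨h3, h4⟩ := hK _ _ (abs_nonneg _) (abs_nonneg _) h2
  have hst : 0 < √(s * t) := Real.sqrt_pos.2 (by positivity)
  have hst' : 0 < √(s' * t') := Real.sqrt_pos.2 (by positivity)
  have h5 : √(s * t) ≤ K * √(s' * t') := by
    refine (Real.sqrt_le_sqrt h1).trans ?_
    rw [Real.sqrt_mul hC.le]
    exact mul_le_mul_of_nonneg_right hCK hst'.le
  have e1 : s * t = √(s * t) ^ 2 := (Real.sq_sqrt (by positivity)).symm
  have e2 : s' * t' = √(s' * t') ^ 2 := (Real.sq_sqrt (by positivity)).symm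
  have hh : 0 < |x - y| := abs_pos.2 (sub_ne_zero.2 hxy)
  have hm : 0 ≤ max x y := hx.trans (le_max_left _ _)
  have ha := abs_nonneg (s - t)
  have ha' := abs_nonneg (s' - t')
  unfold simplifiedEnergy
  rw [e1, e2, Real.sqrt_sq hst.le, Real.sqrt_sq hst'.le]
  generalize √(s * t) = a at *
  generalize √(s' * t') = a' at *
  generalize |s - t| = d at *
  generalize |s' - t'| = d' at *
  generalize |x - y| = h at *
  generalize max x y = μ at *
  have hN : 0 < a * h + d * μ := by positivity
  have hN' : 0 < a' * h + d' * μ := by positivity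
  rcases lt_trichotomy p 2 with hp2 | rfl | hp2
  · have hd := h4 hp2
    have hq : 0 < 2 - p := by linarith
    -- With `N = a h + d μ`, write `a² N^(p-2) = a^p (a/N)^(2-p)`. This is the bound `a/N ≤ K²
    -- a'/N'`, cross-multiplied; in all it costs `K^p * K^(2(2-p))`.
    have hle : a * (a' * h + d' * μ) ≤ K ^ (2 : ℝ) * (a' * (a * h + d * μ)) := by
      rw [Real.rpow_two]
      have i1 : a * (d' * μ) ≤ (K * a') * (K * d * μ) := by gcongr
      have i2 : 1 * (a * a' * h) ≤ K ^ 2 * (a * a' * h) := by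
        gcongr
        exact one_le_pow₀ hK1
      nlinarith
    have hq1 := Real.rpow_le_rpow (by positivity) hle hq.le
    have hq2 := Real.rpow_le_rpow hst.le h5 (by linarith : 0 ≤ p)
    rw [Real.mul_rpow (by positivity) (by positivity), Real.mul_rpow (by positivity) (by positivity),
      Real.mul_rpow (by positivity) (by positivity), ← Real.rpow_mul hK0.le] at hq1
    rw [Real.mul_rpow (by positivity) (by positivity)] at hq2
    have sq : ∀ z : ℝ, 0 < z → z ^ 2 = z ^ p * z ^ (2 - p) := fun z hz => by
      rw [← Real.rpow_add hz, add_sub_cancel, Real.rpow_two]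
    have hmul := mul_le_mul hq2 hq1 (by positivity) (by positivity)
    rw [← neg_sub 2 p, Real.rpow_neg hN.le, Real.rpow_neg hN'.le, abs_neg, abs_of_pos hq,
      Real.rpow_add hK0, sq a hst, sq a' hst']
    rw [← div_eq_mul_inv, ← div_eq_mul_inv, mul_div_assoc', mul_div_assoc', mul_div_assoc',
      div_le_div_iff₀ (by positivity) (by positivity)]
    have := mul_le_mul_of_nonneg_right hmul (sq_nonneg h)
    linarith
  · simp only [sub_self, Real.rpow_zero, abs_zero, mul_zero, add_zero, Real.rpow_two, mul_one]
    calc a ^ 2 * h ^ 2 ≤ (K * a') ^ 2 * h ^ 2 := by gcongr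
      _ = _ := by ring
  · have hd := h3 hp2
    have hq : 0 < p - 2 := by linarith
    have hle : a * h + d * μ ≤ K * (a' * h + d' * μ) := by
      calc a * h + d * μ ≤ (K * a') * h + (K * d') * μ := by gcongr
        _ = _ := by ring
    have hKp : K ^ 2 * K ^ (p - 2) ≤ K ^ (p + 2 * |p - 2|) := by
      rw [← Real.rpow_two, ← Real.rpow_add hK0]
      exact Real.rpow_le_rpow_of_exponent_le hK1 (by linarith [abs_nonneg (p - 2)])
    calc a ^ 2 * (h ^ 2 * (a * h + d * μ) ^ (p - 2))
        ≤ (K * a') ^ 2 * (h ^ 2 * (K * (a' * h + d' * μ)) ^ (p - 2)) := by gcongr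
      _ = (K ^ 2 * K ^ (p - 2)) * (a' ^ 2 * (h ^ 2 * (a' * h + d' * μ) ^ (p - 2))) := by
        rw [Real.mul_rpow hK0.le hN'.le]; ring
      _ ≤ _ := mul_le_mul_of_nonneg_right hKp (by positivity)

/-- By `p`-homogeneity the edge weight is absorbed as a factor `b^(1/p)` of `s` and `t`; both
inequalities of (c) then become the weightless ones. -/
theorem exists_mul_piconeRemainder_le {p C : ℝ} (hp : 1 < p) (hC : 0 < C) :
    ∃ D : ℝ, 0 < D ∧ ∀ b b' s t s' t' x y : ℝ, 0 < b → 0 < b' →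
      0 < s → 0 < t → 0 < s' → 0 < t' → 0 ≤ x → 0 ≤ y →
      b ^ (2 / p) * (s * t) ≤ C * (b' ^ (2 / p) * (s' * t')) →
      ENNReal.ofReal b ^ (1 - 2 / p) * ENNReal.ofReal |s - t| ^ (p - 2) ≤
        ENNReal.ofReal C *
          (ENNReal.ofReal b' ^ (1 - 2 / p) * ENNReal.ofReal |s' - t'| ^ (p - 2)) →
      b * piconeRemainder p s t x y ≤ D * (b' * piconeRemainder p s' t' x y) := by
  obtain ⟨c, C₁, hc, hC₁, hbd⟩ := piconeRemainder_bounds hp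
  obtain ⟨D, hD, h⟩ := exists_simplifiedEnergy_le hp hC
  have hp0 : 0 < p := by linarith
  refine ⟨C₁ * D / c, by positivity,
    fun b b' s t s' t' x y hb hb' hs ht hs' ht' hx hy h1 h2 => ?_⟩
  have hroot : ∀ z : ℝ, 0 < z → z = (z ^ p⁻¹) ^ p := fun z hz =>
    (Real.rpow_inv_rpow hz.le hp0.ne').symm
  have hsq : ∀ z : ℝ, 0 < z → z ^ (2 / p) = z ^ p⁻¹ * z ^ p⁻¹ := fun z hz => by
    rw [← Real.rpow_add hz]; congr 1; ring
  have hgrad : ∀ z w : ℝ, 0 < z → ENNReal.ofReal z ^ (1 - 2 / p) * ENNReal.ofReal |w| ^ (p - 2)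
      = ENNReal.ofReal |z ^ p⁻¹ * w| ^ (p - 2) := fun z w hz => by
    have hz' : 0 < z ^ p⁻¹ := by positivity
    rw [abs_mul, abs_of_pos hz', ENNReal.ofReal_mul hz'.le,
      ENNReal.mul_rpow_of_ne_top ENNReal.ofReal_ne_top ENNReal.ofReal_ne_top,
      ← ENNReal.ofReal_rpow_of_pos hz, ← ENNReal.rpow_mul]
    congr 2
    field_simp
  have hk : 0 < b ^ p⁻¹ := by positivity
  have hk' : 0 < b' ^ p⁻¹ := by positivity
  rw [hgrad _ _ hb, hgrad _ _ hb', mul_sub, mul_sub] at h2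
  rw [hsq b hb, hsq b' hb'] at h1
  have e1 : b * piconeRemainder p s t x y =
      piconeRemainder p (b ^ p⁻¹ * s) (b ^ p⁻¹ * t) x y := by
    rw [piconeRemainder_mul hp hk, ← hroot b hb]
  have e2 : b' * piconeRemainder p s' t' x y =
      piconeRemainder p (b' ^ p⁻¹ * s') (b' ^ p⁻¹ * t') x y := by
    rw [piconeRemainder_mul hp hk', ← hroot b' hb']
  rw [e1, e2]
  have hs1 : 0 < b ^ p⁻¹ * s := by positivity
  have ht1 : 0 < b ^ p⁻¹ * t := by positivity
  have hs1' : 0 < b' ^ p⁻¹ * s' := by positivity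
  have ht1' : 0 < b' ^ p⁻¹ * t' := by positivity
  have i1 := (hbd _ _ x y hs1 ht1 hx hy).2
  have i2 := (hbd _ _ x y hs1' ht1' hx hy).1
  have i3 := h _ _ _ _ x y hs1 ht1 hs1' ht1' hx hy (by linarith) h2
  rw [div_mul_eq_mul_div, le_div_iff₀ hc]
  calc _ ≤ (C₁ * (D * simplifiedEnergy p (b' ^ p⁻¹ * s') (b' ^ p⁻¹ * t') x y)) * c := by
        gcongr; exact i1.trans (by gcongr)
    _ = C₁ * D * (c * simplifiedEnergy p (b' ^ p⁻¹ * s') (b' ^ p⁻¹ * t') x y) := by ring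
    _ ≤ _ := by gcongr

/-! ### Vanishing remainders force equal limits. -/

theorem exists_le_piconeRemainder {p : ℝ} (hp : 1 < p) {s t ε a : ℝ} (hs : 0 < s) (ht : 0 < t)
    (hε : 0 < ε) (ha : 0 ≤ a) :
    ∃ η : ℝ, 0 < η ∧ ∀ x y : ℝ, 0 ≤ x → 0 ≤ y → x ≤ a → ε ≤ |x - y| →
      η ≤ piconeRemainder p s t x y := by
  obtain ⟨c, _, hc, _, hbd⟩ := piconeRemainder_bounds hp
  have hst : 0 < √(s * t) := Real.sqrt_pos.2 (by positivity)
  have hd := abs_nonneg (s - t)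
  suffices H : ∃ η : ℝ, 0 < η ∧ ∀ x y : ℝ, 0 ≤ x → 0 ≤ y → x ≤ a → ε ≤ |x - y| →
      η ≤ |x - y| ^ 2 * (√(s * t) * |x - y| + |s - t| * max x y) ^ (p - 2) by
    obtain ⟨η, hη, H⟩ := H
    refine ⟨c * (s * t * η), by positivity, fun x y hx hy hxa hxy => ?_⟩
    refine le_trans ?_ (hbd s t x y hs ht hx hy).1
    unfold simplifiedEnergy
    gcongr
    exact H x y hx hy hxa hxy
  rcases le_total 2 p with hp2 | hp2
  · refine ⟨ε ^ 2 * (√(s * t) * ε) ^ (p - 2), by positivity, fun x y hx hy hxa hxy => ?_⟩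
    have hm : 0 ≤ max x y := hx.trans (le_max_left _ _)
    have : √(s * t) * ε ≤ √(s * t) * |x - y| + |s - t| * max x y := by
      have := mul_le_mul_of_nonneg_left hxy hst.le
      have := mul_nonneg hd hm
      linarith
    gcongr
  · set P := (√(s * t) + |s - t|) * ε + |s - t| * a with hP
    have hP0 : 0 < P := by positivity
    refine ⟨ε ^ 2 * P ^ (p - 2), by positivity, fun x y hx hy hxa hxy => ?_⟩
    have hm : 0 ≤ max x y := hx.trans (le_max_left _ _)
    have hma : max x y ≤ a + |x - y| := by
      have := neg_abs_le (x - y)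
      have := abs_nonneg (x - y)
      exact max_le (by linarith) (by linarith)
    have hh : 0 < |x - y| := hε.trans_le hxy
    generalize |x - y| = h at *
    generalize max x y = μ at *
    have hθ : 1 ≤ h / ε := (one_le_div hε).2 hxy
    have hN : 0 < √(s * t) * h + |s - t| * μ := by positivity
    -- For `p ≤ 2` the base must be bounded above. It grows at most linearly in `h`, so `h²` times
    -- its power `p - 2` grows at least like `h^p`.
    have hNP : √(s * t) * h + |s - t| * μ ≤ h / ε * P := by
      have i1 : |s - t| * μ ≤ |s - t| * (a + h) := by gcongr
      have i2 : 1 * (|s - t| * a) ≤ h / ε * (|s - t| * a) := by gcongr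
      have i3 : h / ε * P = (√(s * t) + |s - t|) * h + h / ε * (|s - t| * a) := by
        rw [hP]; field_simp
      linarith
    have i4 := Real.rpow_le_rpow_of_nonpos hN hNP (by linarith : p - 2 ≤ 0)
    rw [Real.mul_rpow (by positivity) hP0.le] at i4
    have i5 : 1 ≤ (h / ε) ^ p := Real.one_le_rpow hθ (by linarith)
    have i6 : (h / ε) ^ (p - 2) * h ^ 2 = (h / ε) ^ p * ε ^ 2 := by
      rw [Real.rpow_sub (by positivity), Real.rpow_two]
      field_simp
    calc ε ^ 2 * P ^ (p - 2) = 1 * (ε ^ 2 * P ^ (p - 2)) := by ring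
      _ ≤ (h / ε) ^ p * (ε ^ 2 * P ^ (p - 2)) := by gcongr
      _ = h ^ 2 * ((h / ε) ^ (p - 2) * P ^ (p - 2)) := by
        rw [← mul_assoc, ← i6]; ring
      _ ≤ _ := by gcongr

open Filter Topology in
theorem tendsto_of_piconeRemainder_tendsto_zero {p : ℝ} (hp : 1 < p) {s t : ℝ} (hs : 0 < s)
    (ht : 0 < t) {f g : ℕ → ℝ} (hf : ∀ n, 0 ≤ f n) (hg : ∀ n, 0 ≤ g n) {l : ℝ}
    (hl : Tendsto f atTop (𝓝 l))
    (h : Tendsto (fun n => piconeRemainder p s t (f n) (g n)) atTop (𝓝 0)) :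
    Tendsto g atTop (𝓝 l) := by
  have hl0 : 0 ≤ l := ge_of_tendsto' hl hf
  have hfg : Tendsto (fun n => f n - g n) atTop (𝓝 0) := by
    rw [Metric.tendsto_atTop']
    intro ε hε
    obtain ⟨η, hη, H⟩ := exists_le_piconeRemainder hp hs ht hε (by linarith : 0 ≤ l + 1)
    have h1 := h.eventually_lt_const hη
    have h2 := hl.eventually_lt_const (by linarith : l < l + 1)
    obtain ⟨N, hN⟩ := eventually_atTop.1 (h1.and h2)
    refine ⟨N, fun n hn => ?_⟩
    obtain ⟨h3, h4⟩ := hN n hn.le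
    rw [Real.dist_eq, sub_zero]
    by_contra hcon
    exact absurd (H _ _ (hf n) (hg n) h4.le (not_lt.1 hcon)) (not_le.2 h3)
  simpa using hl.sub hfg

/-! ### Green's formula, ground state representation and the energy functional. -/

variable {X : Type*} {p : ℝ} {b : X → X → ℝ} {m V : X → ℝ}

theorem summable_mul_signedPow (hb : IsConnectedGraph b) (hp : 1 < p) {f : X → ℝ}
    (hf : f ∈ formalDomain p b) (x : X) :
    Summable fun y => b x y * signedPow (f x - f y) (p - 1) := by
  refine Summable.of_norm ((hf x).congr fun y => ?_)
  rw [Real.norm_eq_abs, abs_mul, abs_signedPow (by linarith), abs_of_nonneg (hb.nonneg x y)]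

theorem summable_mul_of_finite_support {φ : X → ℝ} (hφ : (Function.support φ).Finite)
    {g : X → X → ℝ} (hg : ∀ x, Summable (g x)) :
    Summable fun z : X × X => φ z.1 * g z.1 z.2 := by
  refine Summable.of_norm ((summable_prod_of_nonneg fun _ => norm_nonneg _).2 ⟨fun x => ?_, ?_⟩)
  · exact ((hg x).mul_left (φ x)).norm
  · refine summable_of_hasFiniteSupport (hφ.subset fun x hx => ?_)
    contrapose! hx
    simp [Function.notMem_support.1 hx]

theorem tsum_mul_of_finite_support {φ : X → ℝ} (hφ : (Function.support φ).Finite)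
    {g : X → X → ℝ} (hg : ∀ x, Summable (g x)) :
    ∑' z : X × X, φ z.1 * g z.1 z.2 = ∑' x, φ x * ∑' y, g x y := by
  rw [(summable_mul_of_finite_support hφ hg).tsum_prod]
  simp_rw [tsum_mul_left]

/-- Green's formula for functions of the formal domain against finitely supported functions. -/
theorem hasSum_green (hb : IsConnectedGraph b) (hp : 1 < p) {f φ : X → ℝ}
    (hf : f ∈ formalDomain p b) (hφ : (Function.support φ).Finite) :
    HasSum (fun z : X × X => b z.1 z.2 * (signedPow (f z.1 - f z.2) (p - 1) * (φ z.1 - φ z.2)))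
      (2 * ∑' x, φ x * ∑' y, b x y * signedPow (f x - f y) (p - 1)) := by
  have hs := summable_mul_signedPow hb hp hf
  have h := (summable_mul_of_finite_support hφ hs).hasSum
  rw [tsum_mul_of_finite_support hφ hs] at h
  have h' := (Equiv.prodComm X X).hasSum_iff.2 h
  rw [two_mul]
  refine (h.add h').congr_fun fun z => ?_
  simp only [Function.comp_apply, Equiv.prodComm_apply, Prod.fst_swap, Prod.snd_swap]
  rw [hb.symm z.2 z.1, ← neg_sub (f z.1) (f z.2), signedPow_neg]
  ring

theorem summable_energy (hb : IsConnectedGraph b) (hp : 1 < p) {φ : X → ℝ}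
    (hφ : (Function.support φ).Finite) :
    Summable fun z : X × X => b z.1 z.2 * |φ z.1 - φ z.2| ^ p := by
  have hp0 : 0 < p := by linarith
  have hsupp : (Function.support fun x => |φ x| ^ p).Finite := by
    refine hφ.subset fun x hx => ?_
    contrapose! hx
    simp [Function.notMem_support.1 hx, Real.zero_rpow hp0.ne']
  have h := summable_mul_of_finite_support hsupp hb.summable
  have h' := (Equiv.prodComm X X).summable_iff.2 h
  refine Summable.of_nonneg_of_le (fun z => ?_) (fun z => ?_) ((h.add h').mul_left (2 ^ p))
  · exact mul_nonneg (hb.nonneg _ _) (by positivity)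
  · simp only [Function.comp_apply, Equiv.prodComm_apply, Prod.fst_swap, Prod.snd_swap]
    rw [hb.symm z.2 z.1, ← add_mul, mul_comm (_ + _), mul_left_comm]
    refine mul_le_mul_of_nonneg_left ?_ (hb.nonneg _ _)
    have h1 : |φ z.1 - φ z.2| ≤ 2 * max |φ z.1| |φ z.2| := by
      have := abs_sub (φ z.1) (φ z.2)
      linarith [le_max_left |φ z.1| |φ z.2|, le_max_right |φ z.1| |φ z.2|]
    have h2 := Real.rpow_le_rpow (abs_nonneg _) h1 hp0.le
    rw [Real.mul_rpow zero_le_two ((abs_nonneg _).trans (le_max_left _ _))] at h2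
    refine h2.trans (mul_le_mul_of_nonneg_left ?_ (by positivity))
    have := Real.rpow_nonneg (abs_nonneg (φ z.1)) p
    have := Real.rpow_nonneg (abs_nonneg (φ z.2)) p
    rcases max_cases |φ z.1| |φ z.2| with h | h <;> rw [h.1] <;> linarith

/-- The ground state representation: the energy of `f ψ` in terms of Picone remainders. -/
theorem hasSum_piconeRemainder (hb : IsConnectedGraph b) (hm : ∀ x, 0 < m x) (hp : 1 < p)
    {f ψ : X → ℝ} (hf : f ∈ formalDomain p b) (hf0 : ∀ x, 0 ≤ f x)
    (hψ : (Function.support ψ).Finite) (hψ0 : ∀ x, 0 ≤ ψ x) :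
    HasSum (fun z : X × X => b z.1 z.2 * piconeRemainder p (f z.1) (f z.2) (ψ z.1) (ψ z.2))
      (2 * (energy p b m V (fun x => f x * ψ x) -
        ∑' x, m x * schrodinger p b m V f x * (f x * ψ x ^ p))) := by
  have hp0 : 0 < p := by linarith
  have h1 : (Function.support fun x => f x * ψ x).Finite :=
    hψ.subset (Function.support_mul_subset_right f ψ)
  have h2 : (Function.support fun x => f x * ψ x ^ p).Finite := by
    refine hψ.subset fun x hx => ?_
    contrapose! hx
    simp [Function.notMem_support.1 hx, Real.zero_rpow hp0.ne']
  -- Testing Green's formula with `f ψ^p` makes the difference on each edge exactly the Picone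
  -- remainder.
  have h3 := (summable_energy hb hp h1).hasSum.sub (hasSum_green hb hp hf h2)
  have h4 : ∑' x, m x * V x * |f x * ψ x| ^ p =
      ∑' x, m x * schrodinger p b m V f x * (f x * ψ x ^ p) -
      ∑' x, f x * ψ x ^ p * ∑' y, b x y * signedPow (f x - f y) (p - 1) := by
    rw [← Summable.tsum_sub]
    · refine tsum_congr fun x => ?_
      have hfp : signedPow (f x) (p - 1) * f x = f x ^ p := by
        rw [signedPow_of_nonneg (by linarith) (hf0 x)]
        rcases (hf0 x).eq_or_lt with h | h
        · simp [← h, Real.zero_rpow hp0.ne']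
        · rw [Real.rpow_sub_one h.ne']; field_simp
      rw [abs_of_nonneg (mul_nonneg (hf0 x) (hψ0 x)), Real.mul_rpow (hf0 x) (hψ0 x), ← hfp,
        schrodinger, pLaplacian]
      have := (hm x).ne'
      field_simp
      ring
    · refine summable_of_hasFiniteSupport (h2.subset ?_)
      exact Function.support_mul_subset_right _ _
    · refine summable_of_hasFiniteSupport (h2.subset ?_)
      exact Function.support_mul_subset_left _ _
  have h5 : 2 * (energy p b m V (fun x => f x * ψ x) -
      ∑' x, m x * schrodinger p b m V f x * (f x * ψ x ^ p)) =
      ∑' z : X × X, b z.1 z.2 * |f z.1 * ψ z.1 - f z.2 * ψ z.2| ^ p -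
      2 * ∑' x, f x * ψ x ^ p * ∑' y, b x y * signedPow (f x - f y) (p - 1) := by
    unfold energy
    rw [h4]
    ring
  rw [h5]
  refine h3.congr_fun fun z => ?_
  rw [piconeRemainder]
  ring

theorem energy_abs_le (hb : IsConnectedGraph b) (hp : 1 < p) {φ : X → ℝ}
    (hφ : (Function.support φ).Finite) :
    energy p b m V (fun x => |φ x|) ≤ energy p b m V φ := by
  have hφ' : (Function.support fun x => |φ x|).Finite := by
    refine hφ.subset fun x hx => ?_
    contrapose! hx
    simp [Function.notMem_support.1 hx]
  unfold energy
  simp only [abs_abs]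
  gcongr 1 / 2 * ?_ + _
  refine (summable_energy hb hp hφ').tsum_le_tsum (fun z => ?_) (summable_energy hb hp hφ)
  refine mul_le_mul_of_nonneg_left ?_ (hb.nonneg _ _)
  exact Real.rpow_le_rpow (abs_nonneg _) (abs_abs_sub_abs_le _ _) (by linarith)

theorem energy_mul (k : ℝ) (φ : X → ℝ) :
    energy p b m V (fun x => k * φ x) = |k| ^ p * energy p b m V φ := by
  unfold energy
  simp_rw [← mul_sub, abs_mul, Real.mul_rpow (abs_nonneg k) (abs_nonneg _)]
  simp_rw [mul_left_comm _ (|k| ^ p), tsum_mul_left]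
  ring

theorem energy_sub_potential {W φ : X → ℝ} (hp : 1 < p) (hφ : (Function.support φ).Finite) :
    energy p b m (fun x => V x - W x) φ = energy p b m V φ - ∑' x, m x * W x * |φ x| ^ p := by
  have h : ∀ U : X → ℝ, Summable fun x => m x * U x * |φ x| ^ p := fun U => by
    refine summable_of_hasFiniteSupport (hφ.subset fun x hx => ?_)
    contrapose! hx
    simp [Function.notMem_support.1 hx, Real.zero_rpow (by linarith : p ≠ 0)]
  rw [energy, energy, add_sub_assoc, ← (h V).tsum_sub (h W)]
  congr 2
  funext x
  ring

/-! ### Minimum principle, positivity of the energy, existence of null sequences. -/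

/-- The strong minimum principle for positive superharmonic functions. -/
theorem IsSuperharmonic.pos (hb : IsConnectedGraph b) (hm : ∀ x, 0 < m x) (hp : 1 < p)
    {f : X → ℝ} (hf : IsSuperharmonic p b m V f) (hf0 : IsPositive f) (x : X) : 0 < f x := by
  refine (hf0.1 x).lt_of_ne fun hx => hf0.2 ?_
  -- At a zero `y`, the operator reduces to minus a sum of nonnegative terms; superharmonicity makes
  -- each term vanish.
  have step : ∀ y z, f y = 0 → 0 < b y z → f z = 0 := by
    intro y z hy hyz
    have h1 := hf.2 y
    have h2 := summable_mul_signedPow hb hp hf.1 y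
    simp only [schrodinger, pLaplacian, hy, signedPow_zero, mul_zero, add_zero, zero_sub,
      signedPow_neg, mul_neg, tsum_neg] at h1 h2
    have h3 : ∀ w, 0 ≤ b y w * signedPow (f w) (p - 1) := fun w => by
      rw [signedPow_of_nonneg (by linarith) (hf0.1 w)]
      exact mul_nonneg (hb.nonneg _ _) (Real.rpow_nonneg (hf0.1 w) _)
    have h4 : ∑' w, b y w * signedPow (f w) (p - 1) ≤ 0 := by
      have h5 : 0 < 1 / m y := one_div_pos.2 (hm y)
      by_contra hcon
      nlinarith [mul_pos h5 (not_le.1 hcon)]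
    have h5 := (summable_neg_iff.1 h2).le_tsum z fun w _ => h3 w
    have h6 : b y z * signedPow (f z) (p - 1) = 0 := le_antisymm (h5.trans h4) (h3 z)
    rw [signedPow_of_nonneg (by linarith) (hf0.1 z)] at h6
    rcases mul_eq_zero.1 h6 with h | h
    · exact absurd h hyz.ne'
    · exact ((Real.rpow_eq_zero_iff_of_nonneg (hf0.1 z)).1 h).1
  funext y
  induction hb.connected x y with
  | refl => exact hx.symm
  | tail _ hbc ih => exact step _ _ ih hbc

theorem IsSuperharmonic.mul_piconeRemainder_le_energy (hb : IsConnectedGraph b)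
    (hm : ∀ x, 0 < m x) (hp : 1 < p) {f ψ : X → ℝ} (hf : IsSuperharmonic p b m V f)
    (hf0 : ∀ x, 0 < f x) (hψ : (Function.support ψ).Finite) (hψ0 : ∀ x, 0 ≤ ψ x) (x y : X) :
    b x y * piconeRemainder p (f x) (f y) (ψ x) (ψ y) ≤
      2 * energy p b m V (fun x => f x * ψ x) := by
  have h := hasSum_piconeRemainder (V := V) hb hm hp hf.1 (fun x => (hf0 x).le) hψ hψ0
  refine (le_hasSum h (x, y) fun z _ => mul_nonneg (hb.nonneg _ _)
    (piconeRemainder_nonneg hp (hf0 _) (hf0 _) (hψ0 _) (hψ0 _))).trans ?_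
  have : 0 ≤ ∑' x, m x * schrodinger p b m V f x * (f x * ψ x ^ p) :=
    tsum_nonneg fun x => mul_nonneg (mul_nonneg (hm x).le (hf.2 x))
      (mul_nonneg (hf0 x).le (Real.rpow_nonneg (hψ0 x) p))
  linarith

theorem IsPositiveOperator.energyNonneg (hb : IsConnectedGraph b) (hm : ∀ x, 0 < m x)
    (hp : 1 < p) (h : IsPositiveOperator p b m V) : EnergyNonneg p b m V := by
  intro φ hφ
  obtain ⟨f, hf0, hf⟩ := h
  have hpos := hf.pos hb hm hp hf0
  refine le_trans ?_ (energy_abs_le hb hp hφ)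
  rcases isEmpty_or_nonempty X with hX | ⟨⟨o⟩⟩
  · simp [energy]
  have hψ : (Function.support fun x => |φ x| / f x).Finite := by
    refine hφ.subset fun x hx => ?_
    contrapose! hx
    simp [Function.notMem_support.1 hx]
  -- On the pair `(o, o)` the weight is zero, so the bound just says that the energy is nonnegative.
  have h1 := hf.mul_piconeRemainder_le_energy hb hm hp hpos hψ
    (fun x => div_nonneg (abs_nonneg _) (hpos x).le) o o
  have h2 : (fun x => f x * (|φ x| / f x)) = fun x => |φ x| := by
    funext x
    have := (hpos x).ne'
    field_simp
  rw [hb.diag, zero_mul, h2] at h1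
  linarith

/-- Critical operators admit null sequences. -/
theorem IsCritical.exists_nullSequence (hb : IsConnectedGraph b) (hm : ∀ x, 0 < m x)
    (hp : 1 < p) (h : IsCritical p b m V) (o : X) {ε : ℝ} (hε : 0 < ε) :
    ∃ φ : X → ℝ, (Function.support φ).Finite ∧ (∀ x, 0 ≤ φ x) ∧ φ o = 1 ∧
      energy p b m V φ ≤ ε := by
  classical
  have hp0 : 0 < p := by linarith
  -- As `W` is not a Hardy weight, some `φ` has energy below `ε |φ o|^p`; dividing `|φ|` by `|φ o|`
  -- normalises it.
  set W : X → ℝ := Pi.single o (ε / m o) with hW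
  have hWpos : IsPositive W := by
    have h0 : 0 < ε / m o := div_pos hε (hm o)
    refine ⟨fun x => ?_, fun h0' => ?_⟩
    · rcases eq_or_ne x o with rfl | hx
      · simp [hW, h0.le]
      · simp [hW, hx]
    · have := congr_fun h0' o
      simp [hW, h0.ne'] at this
  have hnot : ¬ EnergyNonneg p b m (fun x => V x - W x) := fun hcon => h.2 ⟨h.1, W, hWpos, hcon⟩
  unfold EnergyNonneg at hnot
  push Not at hnot
  obtain ⟨φ, hφ, hlt⟩ := hnot
  rw [energy_sub_potential hp hφ, tsum_eq_single o fun x hx => by simp [hW, hx]] at hlt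
  simp only [hW, Pi.single_eq_same] at hlt
  rw [mul_div_cancel₀ _ (hm o).ne'] at hlt
  have hE := h.1 φ hφ
  have hφo : 0 < |φ o| := by
    refine (abs_nonneg _).lt_of_ne fun h0 => ?_
    rw [← h0, Real.zero_rpow hp0.ne'] at hlt
    linarith
  refine ⟨fun x => |φ o|⁻¹ * |φ x|, ?_, fun x => by positivity, inv_mul_cancel₀ hφo.ne', ?_⟩
  · refine hφ.subset fun x hx => ?_
    contrapose! hx
    simp [Function.notMem_support.1 hx]
  · rw [energy_mul, abs_of_pos (by positivity), Real.inv_rpow hφo.le,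
      inv_mul_le_iff₀ (by positivity)]
    have := energy_abs_le (m := m) (V := V) hb hp hφ
    linarith

end GraphSchrodinger

namespace GraphSchrodinger

/-! ### Limits of null sequences and comparison of two graphs. -/

variable {X : Type*} {p : ℝ} {b b' : X → X → ℝ} {m V V' : X → ℝ}

theorem positivePart_mem_formalDomain (hb : IsConnectedGraph b) (hp : 1 < p) {u : X → ℝ}
    (hu : u ∈ formalDomain p b) :
    positivePart u ∈ formalDomain p b := fun x =>
  Summable.of_nonneg_of_le
    (fun y => mul_nonneg (hb.nonneg _ _) (Real.rpow_nonneg (abs_nonneg _) _))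
    (fun y => mul_le_mul_of_nonneg_left (Real.rpow_le_rpow (abs_nonneg _)
      (abs_max_sub_max_le_abs _ _ _) (by linarith)) (hb.nonneg _ _)) (hu x)

open Filter Topology

theorem signedPow_const_mul {k : ℝ} (hk : 0 < k) (hp : 1 < p) (a : ℝ) :
    signedPow (k * a) (p - 1) = k ^ (p - 1) * signedPow a (p - 1) := by
  rw [mul_comm k, signedPow_mul_of_nonneg (by linarith) hk.le, mul_comm]

theorem schrodinger_const_mul {k : ℝ} (hk : 0 < k) (hp : 1 < p) (f : X → ℝ) (x : X) :
    schrodinger p b m V (fun y => k * f y) x = k ^ (p - 1) * schrodinger p b m V f x := by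
  simp_rw [schrodinger, pLaplacian, ← mul_sub, signedPow_const_mul hk hp,
    mul_left_comm _ (k ^ (p - 1)), tsum_mul_left]
  ring

/-- On a connected graph, a sequence of functions converges pointwise to a constant if its Picone
remainders tend to zero on all edges and it is constant at one vertex. -/
theorem tendsto_of_edges (hb : IsConnectedGraph b) (hp : 1 < p) {f : X → ℝ} (hf : ∀ x, 0 < f x)
    {ψ : ℕ → X → ℝ} (hψ : ∀ n x, 0 ≤ ψ n x) {o : X} {l : ℝ}
    (ho : Tendsto (fun n => ψ n o) atTop (𝓝 l))
    (h : ∀ x y, Tendsto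
      (fun n => b x y * piconeRemainder p (f x) (f y) (ψ n x) (ψ n y)) atTop (𝓝 0)) (x : X) :
    Tendsto (fun n => ψ n x) atTop (𝓝 l) := by
  induction hb.connected o x with
  | refl => exact ho
  | @tail y z _ hyz ih =>
    refine tendsto_of_piconeRemainder_tendsto_zero hp (hf y) (hf z) (fun n => hψ n y)
      (fun n => hψ n z) ih ?_
    have := (h y z).const_mul (b y z)⁻¹
    rw [mul_zero] at this
    refine this.congr fun n => ?_
    rw [inv_mul_cancel_left₀ hyz.ne']

theorem IsSuperharmonic.tendsto_mul_piconeRemainder (hb : IsConnectedGraph b)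
    (hm : ∀ x, 0 < m x) (hp : 1 < p) {f : X → ℝ} (hf : IsSuperharmonic p b m V f)
    (hf0 : ∀ x, 0 < f x) {φ : ℕ → X → ℝ} (hφ : ∀ n, (Function.support (φ n)).Finite)
    (hφ0 : ∀ n x, 0 ≤ φ n x) {ε : ℕ → ℝ} (hε : Tendsto ε atTop (𝓝 0))
    (h : ∀ n, energy p b m V (φ n) ≤ ε n) (x y : X) :
    Tendsto (fun n => b x y * piconeRemainder p (f x) (f y) (φ n x / f x) (φ n y / f y))
      atTop (𝓝 0) := by
  have hε2 : Tendsto (fun n => 2 * ε n) atTop (𝓝 0) := by simpa using hε.const_mul 2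
  have h0 : ∀ n x, 0 ≤ φ n x / f x := fun n x => div_nonneg (hφ0 n x) (hf0 x).le
  refine squeeze_zero (fun n => mul_nonneg (hb.nonneg _ _) (piconeRemainder_nonneg hp (hf0 x)
    (hf0 y) (h0 n x) (h0 n y))) (fun n => ?_) hε2
  have hsupp : (Function.support fun x => φ n x / f x).Finite := by
    refine (hφ n).subset fun x hx => ?_
    contrapose! hx
    simp [Function.notMem_support.1 hx]
  have h1 := hf.mul_piconeRemainder_le_energy hb hm hp hf0 hsupp (h0 n) x y
  have h2 : (fun x => f x * (φ n x / f x)) = φ n := by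
    funext x
    exact mul_div_cancel₀ _ (hf0 x).ne'
  rw [h2] at h1
  linarith [h n]

/-- A nonzero pointwise limit of a null sequence is a multiple of every strictly positive
superharmonic function. -/
theorem IsSuperharmonic.eq_const_mul_of_nullSequence (hb : IsConnectedGraph b)
    (hm : ∀ x, 0 < m x) (hp : 1 < p) {f w : X → ℝ} (hf : IsSuperharmonic p b m V f)
    (hf0 : ∀ x, 0 < f x) {φ : ℕ → X → ℝ} (hφ : ∀ n, (Function.support (φ n)).Finite)
    (hφ0 : ∀ n x, 0 ≤ φ n x) {ε : ℕ → ℝ} (hε : Tendsto ε atTop (𝓝 0))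
    (h : ∀ n, energy p b m V (φ n) ≤ ε n)
    (hw : ∀ x, Tendsto (fun n => φ n x) atTop (𝓝 (w x))) (hw0 : IsPositive w) :
    ∃ k : ℝ, 0 < k ∧ ∀ x, w x = k * f x := by
  obtain ⟨o, ho⟩ : ∃ o, w o ≠ 0 := Function.ne_iff.1 hw0.2
  refine ⟨w o / f o, div_pos ((hw0.1 o).lt_of_ne' ho) (hf0 o), fun x => ?_⟩
  have h1 := tendsto_of_edges hb hp hf0 (fun n x => div_nonneg (hφ0 n x) (hf0 x).le)
    ((hw o).div_const (f o)) (hf.tendsto_mul_piconeRemainder hb hm hp hf0 hφ hφ0 hε h) x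
  rw [← tendsto_nhds_unique ((hw x).div_const (f x)) h1, div_mul_cancel₀ _ (hf0 x).ne']

/-- A Hardy weight `W` with `W o > 0` would give `m o * W o * |φ n o|^p ≤ ε n`, hence `w o = 0` in
the limit. -/
theorem isCritical_of_nullSequence (hm : ∀ x, 0 < m x) (hp : 1 < p)
    (hE : EnergyNonneg p b m V) {w : X → ℝ} (hw0 : ∀ x, 0 < w x)
    {φ : ℕ → X → ℝ} (hφ : ∀ n, (Function.support (φ n)).Finite)
    {ε : ℕ → ℝ} (hε : Tendsto ε atTop (𝓝 0)) (h : ∀ n, energy p b m V (φ n) ≤ ε n)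
    (hw : ∀ x, Tendsto (fun n => φ n x) atTop (𝓝 (w x))) : IsCritical p b m V := by
  refine ⟨hE, fun ⟨_, W, hW, hEW⟩ => ?_⟩
  obtain ⟨o, ho⟩ : ∃ o, W o ≠ 0 := Function.ne_iff.1 hW.2
  have hWo : 0 < m o * W o := mul_pos (hm o) ((hW.1 o).lt_of_ne' ho)
  have hle : ∀ n, m o * W o * |φ n o| ^ p ≤ ε n := by
    intro n
    have h1 := hEW (φ n) (hφ n)
    rw [energy_sub_potential hp (hφ n)] at h1
    have h2 : Summable fun x => m x * W x * |φ n x| ^ p := by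
      refine summable_of_hasFiniteSupport ((hφ n).subset fun x hx => ?_)
      contrapose! hx
      simp [Function.notMem_support.1 hx, Real.zero_rpow (by linarith : p ≠ 0)]
    have h3 := h2.le_tsum o fun x _ => mul_nonneg (mul_nonneg (hm x).le (hW.1 x))
      (Real.rpow_nonneg (abs_nonneg _) p)
    linarith [h n]
  have hlim := (((hw o).abs.rpow_const (p := p) (Or.inr (by linarith))).const_mul (m o * W o))
  have := le_of_tendsto_of_tendsto' hlim hε hle
  have : 0 < m o * W o * |w o| ^ p :=
    mul_pos hWo (Real.rpow_pos_of_pos (abs_pos.2 (hw0 o).ne') p)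
  linarith

/-- Comparison of the energies of two graphs whose Picone remainders are comparable. -/
theorem energy_le_of_piconeRemainder_le (hb : IsConnectedGraph b) (hb' : IsConnectedGraph b')
    (hm : ∀ x, 0 < m x) (hp : 1 < p) {w v ψ : X → ℝ} (hw : IsSubharmonic p b m V w)
    (hw0 : ∀ x, 0 ≤ w x) (hv : IsSuperharmonic p b' m V' v) (hv0 : ∀ x, 0 ≤ v x)
    (hψ : (Function.support ψ).Finite) (hψ0 : ∀ x, 0 ≤ ψ x) {D : ℝ} (hD : 0 < D)
    (h : ∀ x y, b x y * piconeRemainder p (w x) (w y) (ψ x) (ψ y) ≤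
      D * (b' x y * piconeRemainder p (v x) (v y) (ψ x) (ψ y))) :
    energy p b m V (fun x => w x * ψ x) ≤ D * energy p b' m V' (fun x => v x * ψ x) := by
  have h1 := hasSum_piconeRemainder (V := V) hb hm hp hw.1 hw0 hψ hψ0
  have h2 := hasSum_piconeRemainder (V := V') hb' hm hp hv.1 hv0 hψ hψ0
  have h3 := hasSum_le (fun z : X × X => h z.1 z.2) h1 (h2.mul_left D)
  have h4 : ∑' x, m x * schrodinger p b m V w x * (w x * ψ x ^ p) ≤ 0 :=
    tsum_nonpos fun x => mul_nonpos_of_nonpos_of_nonneg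
      (mul_nonpos_of_nonneg_of_nonpos (hm x).le (hw.2 x))
      (mul_nonneg (hw0 x) (Real.rpow_nonneg (hψ0 x) p))
  have h5 : 0 ≤ D * ∑' x, m x * schrodinger p b' m V' v x * (v x * ψ x ^ p) :=
    mul_nonneg hD.le <| tsum_nonneg fun x => mul_nonneg (mul_nonneg (hm x).le (hv.2 x))
      (mul_nonneg (hv0 x) (Real.rpow_nonneg (hψ0 x) p))
  linarith

theorem exists_piconeRemainder_comparison (hb : IsConnectedGraph b) (hb' : IsConnectedGraph b')
    (hp : 1 < p) {u v : X → ℝ} (hv : ∀ x, 0 < v x) {C : ℝ} (hC : 0 < C)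
    (h : ∀ x y, 0 < u x → 0 < u y →
      b x y ^ (2 / p) * (positivePart u x * positivePart u y)
          ≤ C * (b' x y ^ (2 / p) * (v x * v y)) ∧
      (0 < b x y → gradWeight p b (positivePart u) x y
          ≤ ENNReal.ofReal C * gradWeight p b' v x y)) :
    ∃ D : ℝ, 0 < D ∧ ∀ x y s t, 0 ≤ s → 0 ≤ t →
      b x y * piconeRemainder p (positivePart u x) (positivePart u y) s t ≤
        D * (b' x y * piconeRemainder p (v x) (v y) s t) := by
  obtain ⟨D, hD, H⟩ := exists_mul_piconeRemainder_le hp hC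
  refine ⟨D, hD, fun x y s t hs ht => ?_⟩
  have hnn : 0 ≤ D * (b' x y * piconeRemainder p (v x) (v y) s t) :=
    mul_nonneg hD.le (mul_nonneg (hb'.nonneg x y) (piconeRemainder_nonneg hp (hv x) (hv y) hs ht))
  have hu0 : ∀ z, 0 ≤ positivePart u z := fun z => le_max_right _ _
  rcases (hb.nonneg x y).eq_or_lt with hbxy | hbxy
  · rwa [← hbxy, zero_mul]
  rcases le_or_gt (u x) 0 with hx | hx
  · rw [show positivePart u x = 0 from max_eq_right hx, piconeRemainder_zero_left hp (hu0 y) ht,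
      mul_zero]
    exact hnn
  rcases le_or_gt (u y) 0 with hy | hy
  · rw [show positivePart u y = 0 from max_eq_right hy, piconeRemainder_swap,
      piconeRemainder_zero_left hp (hu0 x) hs, mul_zero]
    exact hnn
  obtain ⟨h1, h2⟩ := h x y hx hy
  have hux : 0 < positivePart u x := lt_max_of_lt_left hx
  have huy : 0 < positivePart u y := lt_max_of_lt_left hy
  -- The first inequality of (c) forces every edge of `b` inside `{u > 0}` to be an edge of `b'`.
  have hb'xy : 0 < b' x y := by
    refine (hb'.nonneg x y).lt_of_ne fun h0 => ?_
    rw [← h0, Real.zero_rpow (by positivity), zero_mul, mul_zero] at h1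
    have : 0 < b x y ^ (2 / p) * (positivePart u x * positivePart u y) := by positivity
    linarith
  exact H _ _ _ _ _ _ s t hbxy hb'xy hux huy (hv x) (hv y) hs ht h1 (h2 hbxy)

end GraphSchrodinger

/-! ### The Liouville comparison principle. -/

open GraphSchrodinger Filter Topology in
theorem mainTheorem2 {X : Type*} [Countable X] [Infinite X]
    (p : ℝ) (hp : 1 < p)
    (m : X → ℝ) (hm : ∀ x, 0 < m x)
    (b b' : X → X → ℝ)
    (hb : GraphSchrodinger.IsConnectedGraph b) (hb' : GraphSchrodinger.IsConnectedGraph b')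
    (V V' : X → ℝ)
    (hH : GraphSchrodinger.IsPositiveOperator p b m V)
    (hH' : GraphSchrodinger.IsPositiveOperator p b' m V')
    (u v : X → ℝ)
    (hu : u ∈ GraphSchrodinger.formalDomain p b)
    (hv : v ∈ GraphSchrodinger.formalDomain p b')
    (hcrit' : GraphSchrodinger.IsCritical p b' m V')
    (hground' : GraphSchrodinger.IsAgmonGroundState p b' m V' v)
    (hu_ne : GraphSchrodinger.positivePart u ≠ 0)
    (hu_sub : ∀ x, GraphSchrodinger.schrodinger p b m V (GraphSchrodinger.positivePart u) x ≤ 0)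
    (hcomp : ∃ C : ℝ, 0 < C ∧ ∀ x y, 0 < u x → 0 < u y →
      b x y ^ (2 / p) * (GraphSchrodinger.positivePart u x * GraphSchrodinger.positivePart u y)
          ≤ C * (b' x y ^ (2 / p) * (v x * v y)) ∧
      (0 < b x y →
        GraphSchrodinger.gradWeight p b (GraphSchrodinger.positivePart u) x y
          ≤ ENNReal.ofReal C * GraphSchrodinger.gradWeight p b' v x y)) :
    GraphSchrodinger.IsCritical p b m V ∧
      (∀ x, 0 < u x) ∧
      GraphSchrodinger.IsAgmonGroundState p b m V u := by
  obtain ⟨C, hC, hcomp⟩ := hcomp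
  obtain ⟨D, hD, hR⟩ := exists_piconeRemainder_comparison hb hb' hp hground'.pos hC hcomp
  have hv0 := hground'.pos
  have hw0 : ∀ x, 0 ≤ positivePart u x := fun x => le_max_right _ _
  have hw : IsSubharmonic p b m V (positivePart u) :=
    ⟨positivePart_mem_formalDomain hb hp hu, hu_sub⟩
  obtain ⟨o⟩ : Nonempty X := inferInstance
  have hδ : Tendsto (fun n : ℕ => 1 / ((n : ℝ) + 1)) atTop (𝓝 0) :=
    tendsto_one_div_add_atTop_nhds_zero_nat
  choose φ hφ hφ0 hφo hφE using fun n : ℕ =>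
    hcrit'.exists_nullSequence hb' hm hp o (ε := 1 / ((n : ℝ) + 1)) (by positivity)
  set ψ : ℕ → X → ℝ := fun n x => φ n x / v x with hψ
  have hψ0 : ∀ n x, 0 ≤ ψ n x := fun n x => div_nonneg (hφ0 n x) (hv0 x).le
  have hψs : ∀ n, (Function.support (ψ n)).Finite := fun n => by
    refine (hφ n).subset fun x hx => ?_
    contrapose! hx
    simp [hψ, Function.notMem_support.1 hx]
  have hvψ : ∀ n, (fun x => v x * ψ n x) = φ n := fun n => by
    funext x
    exact mul_div_cancel₀ _ (hv0 x).ne'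
  have hψlim : ∀ x, Tendsto (fun n => ψ n x) atTop (𝓝 (1 / v o)) :=
    tendsto_of_edges hb' hp hv0 hψ0 (o := o) (by simp [hψ, hφo])
      (hground'.harmonic.1.tendsto_mul_piconeRemainder hb' hm hp hv0 hφ hφ0 hδ hφE)
  have hE : ∀ n, energy p b m V (fun x => positivePart u x * ψ n x) ≤
      D * (1 / ((n : ℝ) + 1)) := fun n => by
    refine (energy_le_of_piconeRemainder_le hb hb' hm hp hw hw0 hground'.harmonic.1
      (fun x => (hv0 x).le) (hψs n) (hψ0 n) hD
      fun x y => hR x y _ _ (hψ0 n x) (hψ0 n y)).trans ?_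
    rw [hvψ]
    exact mul_le_mul_of_nonneg_left (hφE n) hD.le
  have hDδ : Tendsto (fun n : ℕ => D * (1 / ((n : ℝ) + 1))) atTop (𝓝 0) := by
    simpa using hδ.const_mul D
  have hs : ∀ n, (Function.support fun x => positivePart u x * ψ n x).Finite := fun n =>
    (hψs n).subset (Function.support_mul_subset_right _ _)
  have hlim : ∀ x, Tendsto (fun n => positivePart u x * ψ n x) atTop
      (𝓝 (positivePart u x * (1 / v o))) := fun x => (hψlim x).const_mul _
  have hlpos : 0 < 1 / v o := one_div_pos.2 (hv0 o)
  have hwpos : IsPositive fun x => positivePart u x * (1 / v o) := by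
    refine ⟨fun x => mul_nonneg (hw0 x) hlpos.le, fun h0 => hu_ne ?_⟩
    funext x
    exact (mul_eq_zero.1 (congr_fun h0 x)).resolve_right hlpos.ne'
  -- `u₊ ψ n` acts as a null sequence with nonzero limit `u₊ / v o`, which must be proportional to
  -- each such `g`.
  have hmul : ∀ g : X → ℝ, IsPositive g → IsSuperharmonic p b m V g →
      ∃ k : ℝ, 0 < k ∧ ∀ x, positivePart u x = k * g x := by
    intro g hg0 hg
    obtain ⟨k, hk, h⟩ := hg.eq_const_mul_of_nullSequence hb hm hp (hg.pos hb hm hp hg0) hs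
      (fun n x => mul_nonneg (hw0 x) (hψ0 n x)) hDδ hE hlim hwpos
    refine ⟨v o * k, mul_pos (hv0 o) hk, fun x => ?_⟩
    have := (hv0 o).ne'
    rw [mul_assoc, ← h x]
    field_simp
  obtain ⟨g, hg0, hg⟩ := id hH
  obtain ⟨k, hk, hkg⟩ := hmul g hg0 hg
  have hwp : ∀ x, 0 < positivePart u x := fun x => by
    rw [hkg x]
    exact mul_pos hk (hg.pos hb hm hp hg0 x)
  have hupos : ∀ x, 0 < u x := fun x => by
    have := hwp x
    simpa [positivePart] using this
  have huw : positivePart u = u := funext fun x => max_eq_left (hupos x).le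
  rw [huw] at hw hkg hmul hwp
  refine ⟨isCritical_of_nullSequence hm hp (hH.energyNonneg hb hm hp)
    (fun x => mul_pos (by rw [huw]; exact hwp x) hlpos) hs hDδ hE hlim, hupos,
    ⟨hupos, ⟨⟨hu, fun x => ?_⟩, hw⟩, fun f hf0 hf => ?_⟩⟩
  -- The missing half of harmonicity is inherited from the superharmonic `g`.
  · rw [show u = fun y => k * g y from funext hkg, schrodinger_const_mul hk hp]
    exact mul_nonneg (Real.rpow_nonneg hk.le _) (hg.2 x)
  · obtain ⟨c, hc, h⟩ := hmul f hf0 hf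
    refine ⟨c⁻¹, inv_pos.2 hc, fun x => ?_⟩
    rw [h x, inv_mul_cancel_left₀ hc.ne']
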